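/- Let $\mathcal{C}_n=\{0,1\}^n$ be the Boolean cube with componentwise addition modulo $2$ and the Hamming distance $d$. The weight of a word is its number of non-zero coordinates; $E$ and $O$ denote the sets of words of even and of odd weight, and $T_{a}(c)=c+a$. For $P\subseteq\{1,\dots,n\}$, a $P$-isometry of $\mathcal{C}_n$ is a bijection $\phi:\mathcal{C}_n\to\mathcal{C}_n$ such that, for all $p\in P$ and all words $x,y$, $d(x,y)=p$ implies $d(\phi(x),\phi(y))=p$. A $p$-isometry is a $\{p\}$-isometry, an isometry is a bijection preserving all distances, and an even isometry is a $P$-isometry with $P$ the set of all even numbers in $\{1,\dots,n\}$. Given $i,j\in\{1,\dots,n\}$ (possibly equal) and a bijection $\sigma:\{1,\dots,n\}\setminus\{i\}\to\{1,\dots,n\}\setminus\{j\}$, the corresponding $\sigma_{i,j}$-mapping on $\mathcal{C}_n$ sends $c=(c_1,\dots,c_n)$ to $d=(d_1,\dots,d_n)$, where $d_k=c_{\sigma^{-1}(k)}$ for $k\ne j$ and $d_j=0$ if $c_i=0$, and $d_k=c_{\sigma^{-1}(k)}+1$ for $k\neq j$ and $d_j=1$ if $c_i=1$. (1) Let $n\equiv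 1\pmod 4$. If $\phi$ is an $\frac{n+1}{2}$-isometry of $\mathcal{C}_n$ with $\phi(\overline{0})=\overline{0}$ that is not an isometry, then $\phi$ is a $\sigma_{i,j}$-mapping on $\mathcal{C}_n$ for some $i$, $j$ and $\sigma$. Conversely, every $\sigma_{i,j}$-mapping on $\mathcal{C}_n$ is an $\frac{n+1}{2}$-isometry. (2) Let $n\equiv 3\pmod 4$. If $\phi$ is an $\frac{n+1}{2}$-isometry of $\mathcal{C}_n$ with $\phi(\overline{0})=\overline{0}$ that is not an even isometry, then at least one of the following holds: I) there are a $\sigma_{i,j}$-mapping $\tau$ on $\mathcal{C}_n$ and a word $a$ of even weight such that $\phi$ coincides on $E$ with some even isometry of $\mathcal{C}_n$, and $\phi=T_{a}\circ\tau$ on $O$; II) there is a $\sigma_{i,j}$-mapping $\tau$ on $\mathcal{C}_n$ such that $\phi=\tau$ on $E$, and $\phi$ coincides on $O$ with some even isometry of $\mathcal{C}_n$; III) there are a $\sigma_{i,j}$-mapping $\tau_1$ and a $\sigma_{k,l}$-mapping $\tau_2$ on $\mathcal{C}_n$ and a word $a$ of even weight such that $\phi=\tau_1$ on $E$ and $\phi=T_{a}\circ\tau_2$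 on $O$. -/

import Mathlib

/-- The Boolean cube `C_n`: words of length `n` over `ℤ/2`, with componentwise addition.
Its metric is Mathlib's `hammingDist`, and the weight of a word is `hammingNorm`. -/
abbrev BoolCube (n : ℕ) : Type := Fin n → ZMod 2

/-- A `P`-isometry: a bijection of `C_n` preserving every Hamming distance in `P`. -/
def IsWeakIsometry {n : ℕ} (P : Set ℕ) (φ : BoolCube n → BoolCube n) : Prop :=
  Function.Bijective φ ∧
    ∀ p ∈ P, ∀ x y : BoolCube n, hammingDist x y = p → hammingDist (φ x) (φ y) = p

/-- An isometry: a bijection of `C_n` preserving all Hamming distances. -/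
def IsCubeIsometry {n : ℕ} (φ : BoolCube n → BoolCube n) : Prop :=
  Function.Bijective φ ∧ ∀ x y : BoolCube n, hammingDist (φ x) (φ y) = hammingDist x y

/-- An even isometry: a `P`-isometry for `P` the set of all even numbers in `{1, …, n}`. -/
def IsEvenIsometry {n : ℕ} (φ : BoolCube n → BoolCube n) : Prop :=
  IsWeakIsometry {p : ℕ | p ∈ Set.Icc 1 n ∧ Even p} φ

/-- The set `E` of words of even weight. -/
def evenWords (n : ℕ) : Set (BoolCube n) := {c | Even (hammingNorm c)}

/-- The set `O` of words of odd weight. -/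
def oddWords (n : ℕ) : Set (BoolCube n) := {c | Odd (hammingNorm c)}

/-- The translation `T_a : c ↦ c + a`. -/
def cubeTranslation {n : ℕ} (a : BoolCube n) : BoolCube n → BoolCube n := fun c => c + a

/-- `φ` is the `σ_{i,j}`-mapping on `C_n` attached to the positions `i`, `j` and to the bijection
`σ` from the positions other than `i` to the positions other than `j`. -/
def IsSigmaMappingOf {n : ℕ} (i j : Fin n) (σ : {k : Fin n // k ≠ i} ≃ {k : Fin n // k ≠ j})
    (φ : BoolCube n → BoolCube n) : Prop :=
  ∀ c : BoolCube n,
    (c i = 0 → (∀ k : {k : Fin n // k ≠ j}, φ c k = c (σ.symm k)) ∧ φ c j = 0) ∧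
    (c i = 1 → (∀ k : {k : Fin n // k ≠ j}, φ c k = c (σ.symm k) + 1) ∧ φ c j = 1)

/-- `φ` is a `σ_{i,j}`-mapping on `C_n` for some `i`, `j` (possibly equal) and some `σ`. -/
def IsSigmaMapping {n : ℕ} (φ : BoolCube n → BoolCube n) : Prop :=
  ∃ (i j : Fin n) (σ : {k : Fin n // k ≠ i} ≃ {k : Fin n // k ≠ j}), IsSigmaMappingOf i j σ φ

/-- `φ` acts on the words of `A` as some even isometry of `C_n` does. -/
def ActsAsEvenIsometryOn {n : ℕ} (φ : BoolCube n → BoolCube n) (A : Set (BoolCube n)) : Prop :=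
  ∃ ψ : BoolCube n → BoolCube n, IsEvenIsometry ψ ∧ Set.EqOn φ ψ A

/-! Put `p = (n + 1) / 2`. For words at distance `2i`, twice the number of words at distance `p`
from both is the product of the central binomial coefficients of `i` and `p - i`; at odd distance
there are none. This product is symmetric under `i ↔ p - i` and strictly decreasing up to the
middle. A `p`-isometry preserves these counts, so it keeps the parity of every distance, and every
even distance `d` up to `d ↔ n + 1 - d` (`dist_of_card_commonNeighbours_eq`).

This ambiguity is the geometry of the folded cube: `C_n` is the `(n + 1)`-cube modulo its all-ones
word, and there all `n + 1` coordinates play the same role. On `E`, a map `φ` fixing `0` permutes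
the words of 2-subsets and respects intersections, so it comes from a permutation `π` of `n + 1`
points (`exists_perm_of_pairs`). Folded distances to these words and to `0` determine a word, hence
`φ = foldPerm π` on `E`. Conjugating by an odd translation gives the same on `O`, up to an even
translation. If `π` fixes the extra coordinate, `foldPerm π` is an isometry; otherwise it is a
`σ_{i,j}`-mapping.

For odd `p`, words at distance `p` have opposite parity, so the action on `E` forces the one on `O`.
For even `p` the two halves are treated separately: of the four combinations one makes `φ` an even
isometry, and the others are I, II and III. -/

/-! ### Common neighbours and the distances they determine -/

section Counting

/-- The words at distance `p` from both `x` and `y`. -/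
def commonNeighbours {n : ℕ} (p : ℕ) (x y : BoolCube n) : Finset (BoolCube n) :=
  Finset.univ.filter fun z => hammingDist x z = p ∧ hammingDist y z = p

lemma cube_add_self {n : ℕ} (x : BoolCube n) : x + x = 0 :=
  funext fun k => CharTwo.add_self_eq_zero (x k)

lemma cube_add_add_cancel {n : ℕ} (x y : BoolCube n) : x + y + y = x := by
  rw [add_assoc, cube_add_self, add_zero]

lemma hammingDist_eq_norm_add {n : ℕ} (x y : BoolCube n) :
    hammingDist x y = hammingNorm (x + y) := by
  rw [hammingDist_eq_hammingNorm]
  congr 1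
  funext k
  simp [CharTwo.neg_eq]

lemma hammingDist_add_right {n : ℕ} (x y a : BoolCube n) :
    hammingDist (x + a) (y + a) = hammingDist x y := by
  rw [hammingDist_eq_norm_add, hammingDist_eq_norm_add, add_add_add_comm, cube_add_self, add_zero]

lemma hammingNorm_eq_add {n : ℕ} (u z : BoolCube n) :
    hammingNorm z = (Finset.univ.filter fun k => u k ≠ 0 ∧ z k ≠ 0).card +
      (Finset.univ.filter fun k => u k = 0 ∧ z k ≠ 0).card := by
  rw [hammingNorm, ← Finset.card_filter_add_card_filter_not (fun k => u k ≠ 0),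
    Finset.filter_filter, Finset.filter_filter]
  congr 2 <;> ext k <;> simp [and_comm]

lemma zmod_two_add_ne_zero_iff (a b : ZMod 2) :
    a + b ≠ 0 ↔ (a ≠ 0 ∧ b = 0) ∨ (a = 0 ∧ b ≠ 0) := by
  revert a b; decide

lemma hammingNorm_add_eq {n : ℕ} (u z : BoolCube n) :
    hammingNorm (u + z) + (Finset.univ.filter fun k => u k ≠ 0 ∧ z k ≠ 0).card =
      hammingNorm u + (Finset.univ.filter fun k => u k = 0 ∧ z k ≠ 0).card := by
  have h1 := hammingNorm_eq_add u (u + z)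
  have h2 := hammingNorm_eq_add z u
  have h3 : (Finset.univ.filter fun k => u k = 0 ∧ (u + z) k ≠ 0) =
      Finset.univ.filter fun k => u k = 0 ∧ z k ≠ 0 := by
    ext k
    simp only [Finset.mem_filter, Finset.mem_univ, true_and, Pi.add_apply,
      zmod_two_add_ne_zero_iff]
    tauto
  have h4 : (Finset.univ.filter fun k => u k ≠ 0 ∧ (u + z) k ≠ 0) =
      Finset.univ.filter fun k => z k = 0 ∧ u k ≠ 0 := by
    ext k
    simp only [Finset.mem_filter, Finset.mem_univ, true_and, Pi.add_apply,
      zmod_two_add_ne_zero_iff]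
    tauto
  have h5 : (Finset.univ.filter fun k => z k ≠ 0 ∧ u k ≠ 0) =
      Finset.univ.filter fun k => u k ≠ 0 ∧ z k ≠ 0 := by
    ext k; simp [and_comm]
  rw [h3, h4] at h1
  rw [h5] at h2
  omega

lemma even_hammingNorm_add {n : ℕ} (x y : BoolCube n) :
    Even (hammingNorm (x + y)) ↔ (Even (hammingNorm x) ↔ Even (hammingNorm y)) := by
  have h1 := hammingNorm_add_eq x y
  have h2 := hammingNorm_eq_add x y
  rw [← Nat.even_add]
  simp only [Nat.even_iff]
  omega

lemma even_hammingDist {n : ℕ} (x y : BoolCube n) :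
    Even (hammingDist x y) ↔ (Even (hammingNorm x) ↔ Even (hammingNorm y)) := by
  rw [hammingDist_eq_norm_add, even_hammingNorm_add]

lemma commonNeighbours_eq_empty {n p : ℕ} {x y : BoolCube n} (h : ¬ Even (hammingDist x y)) :
    commonNeighbours p x y = ∅ := by
  rw [commonNeighbours, Finset.filter_eq_empty_iff]
  rintro z - ⟨h1, h2⟩
  have e1 := even_hammingDist x z
  have e2 := even_hammingDist y z
  rw [even_hammingDist] at h
  rw [h1] at e1
  rw [h2] at e2
  tauto

/-- Adding `u` preserves the weight of `z` exactly when `z` contains half of the support of `u`; the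
remaining `p - i` ones of `z` lie outside it. -/
lemma card_filter_hammingNorm {n p i : ℕ} (u : BoolCube n) (hu : hammingNorm u = 2 * i)
    (hi : i ≤ p) :
    (Finset.univ.filter fun z : BoolCube n => hammingNorm z = p ∧ hammingNorm (u + z) = p).card =
      (2 * i).choose i * (n - 2 * i).choose (p - i) := by
  set U : Finset (Fin n) := Finset.univ.filter fun k => u k ≠ 0 with hU
  have hUc : U.card = 2 * i := hu
  have hUc' : Uᶜ.card = n - 2 * i := by rw [Finset.card_compl, hUc, Fintype.card_fin]
  rw [← hUc', ← hUc, ← Finset.card_powersetCard, ← Finset.card_powersetCard,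
    ← Finset.card_product]
  refine Finset.card_nbij'
    (fun z => (Finset.univ.filter fun k => u k ≠ 0 ∧ z k ≠ 0,
      Finset.univ.filter fun k => u k = 0 ∧ z k ≠ 0))
    (fun s => fun k => if k ∈ s.1 ∨ k ∈ s.2 then 1 else 0) ?_ ?_ ?_ ?_
  · intro z hz
    simp only [Finset.coe_filter, Finset.mem_univ, true_and, Set.mem_ofPred_eq] at hz
    have h1 := hammingNorm_eq_add u z
    have h2 := hammingNorm_add_eq u z
    simp only [Finset.coe_product, Set.mem_prod, Finset.mem_coe, Finset.mem_powersetCard]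
    refine ⟨⟨?_, by omega⟩, ?_, by omega⟩
    · intro k; simp +contextual [hU]
    · intro k; simp +contextual [hU]
  · rintro ⟨A, B⟩ hs
    simp only [Finset.coe_product, Set.mem_prod, Finset.mem_coe, Finset.mem_powersetCard] at hs
    obtain ⟨⟨hA, hA'⟩, hB, hB'⟩ := hs
    have hAu : ∀ k ∈ A, u k ≠ 0 := fun k hk => by simpa [hU] using hA hk
    have hBu : ∀ k ∈ B, u k = 0 := fun k hk => by simpa [hU] using hB hk
    set z : BoolCube n := fun k => if k ∈ A ∨ k ∈ B then 1 else 0 with hz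
    have e1 : (Finset.univ.filter fun k => u k ≠ 0 ∧ z k ≠ 0) = A := by
      ext k
      have := hAu k
      have := hBu k
      simp [hz]; tauto
    have e2 : (Finset.univ.filter fun k => u k = 0 ∧ z k ≠ 0) = B := by
      ext k
      have := hAu k
      have := hBu k
      simp [hz]; tauto
    have h1 := hammingNorm_eq_add u z
    have h2 := hammingNorm_add_eq u z
    rw [e1, e2] at h1 h2
    simp only [Finset.coe_filter, Finset.mem_univ, true_and, Set.mem_ofPred_eq]
    change hammingNorm z = p ∧ hammingNorm (u + z) = p
    omega
  · intro z _
    funext k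
    have : ∀ a : ZMod 2, a ≠ 0 → a = 1 := by decide
    by_cases h : z k = 0
    · simp [h]
    · by_cases h' : u k = 0 <;> simp [h', this _ h]
  · rintro ⟨A, B⟩ hs
    simp only [Finset.coe_product, Set.mem_prod, Finset.mem_coe, Finset.mem_powersetCard] at hs
    obtain ⟨⟨hA, -⟩, hB, -⟩ := hs
    have hAu : ∀ k ∈ A, u k ≠ 0 := fun k hk => by simpa [hU] using hA hk
    have hBu : ∀ k ∈ B, u k = 0 := fun k hk => by simpa [hU] using hB hk
    ext k
    · have := hAu k
      have := hBu k
      simp; tauto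
    · have := hAu k
      have := hBu k
      simp; tauto

lemma two_mul_choose_eq_centralBinom {m : ℕ} (hm : 0 < m) :
    2 * (2 * m - 1).choose m = m.centralBinom := by
  obtain ⟨k, rfl⟩ : ∃ k, m = k + 1 := ⟨m - 1, by omega⟩
  have h := Nat.choose_symm_half k
  rw [Nat.centralBinom, show 2 * (k + 1) = 2 * k + 1 + 1 by ring, Nat.choose_succ_succ,
    Nat.add_sub_cancel, h, two_mul]

/-- Since `n - 2i = 2(p - i) - 1`, doubling turns the second factor into a central binomial
coefficient and exposes the symmetry `i ↔ p - i`. -/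
lemma two_mul_card_commonNeighbours {n p i : ℕ} (hn : n + 1 = 2 * p) (x y : BoolCube n)
    (h : hammingDist x y = 2 * i) :
    2 * (commonNeighbours p x y).card = i.centralBinom * (p - i).centralBinom := by
  have hle : hammingDist x y ≤ n := by simpa using hammingDist_le_card_fintype (x := x) (y := y)
  have hip : i < p := by omega
  rw [hammingDist_eq_norm_add] at h
  have key := card_filter_hammingNorm (p := p) (x + y) h hip.le
  have : (commonNeighbours p x y).card = (Finset.univ.filter fun z : BoolCube n =>
      hammingNorm z = p ∧ hammingNorm (x + y + z) = p).card := by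
    refine Finset.card_nbij' (fun z => z + x) (fun z => z + x) ?_ ?_ ?_ ?_
    · intro z hz
      simp only [commonNeighbours, hammingDist_eq_norm_add, Finset.coe_filter, Finset.mem_univ,
        true_and, Set.mem_ofPred_eq] at hz ⊢
      rw [add_comm z x, show x + y + (x + z) = y + z + x + x by abel, cube_add_add_cancel]
      exact hz
    · intro z hz
      simp only [commonNeighbours, hammingDist_eq_norm_add, Finset.coe_filter, Finset.mem_univ,
        true_and, Set.mem_ofPred_eq] at hz ⊢
      rw [show x + (z + x) = z + x + x by abel, cube_add_add_cancel,
        show y + (z + x) = x + y + z by abel]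
      exact hz
    · intro z _; exact cube_add_add_cancel z x
    · intro z _; exact cube_add_add_cancel z x
  rw [this, key, show n - 2 * i = 2 * (p - i) - 1 by omega, mul_left_comm,
    two_mul_choose_eq_centralBinom (by omega), ← Nat.centralBinom_eq_two_mul_choose]

/-- The ratio of consecutive central binomials, `2(2i + 1)/(i + 1)`, increases with `i`. With `m = p
- i - 1` the claim becomes `(2i + 1)(m + 1) < (2m + 1)(i + 1)`, that is, `i < m`. -/
lemma centralBinom_mul_lt {p i : ℕ} (h : 2 * i + 1 < p) :
    (i + 1).centralBinom * (p - (i + 1)).centralBinom <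
      i.centralBinom * (p - i).centralBinom := by
  obtain ⟨m, rfl⟩ : ∃ m, p = i + 1 + m := ⟨p - (i + 1), by omega⟩
  have e1 : i + 1 + m - (i + 1) = m := by omega
  have e2 : i + 1 + m - i = m + 1 := by omega
  rw [e1, e2]
  have h1 := Nat.succ_mul_centralBinom_succ i
  have h2 := Nat.succ_mul_centralBinom_succ m
  have p1 := Nat.centralBinom_pos i
  have p2 := Nat.centralBinom_pos m
  have hmul : 0 < i.centralBinom * m.centralBinom := Nat.mul_pos p1 p2
  have him : i < m := by omega
  have a1 : (i + 1) * (m + 1) * ((i + 1).centralBinom * m.centralBinom) =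
      (2 * (2 * i + 1) * (m + 1)) * (i.centralBinom * m.centralBinom) := by
    calc _ = (m + 1) * m.centralBinom * ((i + 1) * (i + 1).centralBinom) := by ring
      _ = _ := by rw [h1]; ring
  have a2 : (i + 1) * (m + 1) * (i.centralBinom * (m + 1).centralBinom) =
      (2 * (2 * m + 1) * (i + 1)) * (i.centralBinom * m.centralBinom) := by
    calc _ = (i + 1) * i.centralBinom * ((m + 1) * (m + 1).centralBinom) := by ring
      _ = _ := by rw [h2]; ring
  refine lt_of_mul_lt_mul_left (a := (i + 1) * (m + 1)) ?_ (Nat.zero_le _)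
  rw [a1, a2]
  exact Nat.mul_lt_mul_of_pos_right (by nlinarith) hmul

lemma centralBinom_mul_lt_of_lt {p i j : ℕ} (hij : i < j) (hj : 2 * j ≤ p) :
    j.centralBinom * (p - j).centralBinom < i.centralBinom * (p - i).centralBinom := by
  induction j, hij using Nat.le_induction with
  | base => exact centralBinom_mul_lt (by omega)
  | succ j _ ih => exact (centralBinom_mul_lt (by omega)).trans (ih (by omega))

lemma centralBinom_mul_eq {p i j : ℕ} (hi : i ≤ p) (hj : j ≤ p)
    (h : i.centralBinom * (p - i).centralBinom = j.centralBinom * (p - j).centralBinom) :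
    i = j ∨ i + j = p := by
  have key : ∀ i j : ℕ, 2 * i ≤ p → 2 * j ≤ p →
      i.centralBinom * (p - i).centralBinom = j.centralBinom * (p - j).centralBinom → i = j := by
    intro i j hi hj h
    rcases lt_trichotomy i j with h' | h' | h'
    · exact absurd h (centralBinom_mul_lt_of_lt h' hj).ne'
    · exact h'
    · exact absurd h (centralBinom_mul_lt_of_lt h' hi).ne
  have flip : ∀ k ≤ p, k.centralBinom * (p - k).centralBinom =
      (p - k).centralBinom * (p - (p - k)).centralBinom := by
    intro k hk
    rw [Nat.sub_sub_self hk, mul_comm]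
  rcases le_total (2 * i) p with hi' | hi' <;> rcases le_total (2 * j) p with hj' | hj'
  · exact Or.inl (key _ _ hi' hj' h)
  · rw [flip j hj] at h
    have := key _ _ hi' (by omega) h
    omega
  · rw [flip i hi] at h
    have := key _ _ (by omega) hj' h
    omega
  · rw [flip i hi, flip j hj] at h
    have := key _ _ (by omega) (by omega) h
    omega

/-- The number of common neighbours determines the parity of the distance and, for even distances,
the distance up to `d ↔ n + 1 - d`. -/
lemma dist_of_card_commonNeighbours_eq {n p : ℕ} (hn : n + 1 = 2 * p) {x y x' y' : BoolCube n}
    (h : (commonNeighbours p x y).card = (commonNeighbours p x' y').card)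
    (he : Even (hammingDist x y)) :
    Even (hammingDist x' y') ∧ (hammingDist x' y' = hammingDist x y ∨
      hammingDist x' y' + hammingDist x y = n + 1) := by
  obtain ⟨i, hi⟩ := he
  have hc := two_mul_card_commonNeighbours hn x y (i := i) (by omega)
  have hpos : 0 < (commonNeighbours p x y).card := by
    have := Nat.mul_pos (Nat.centralBinom_pos i) (Nat.centralBinom_pos (p - i))
    omega
  have he' : Even (hammingDist x' y') := by
    by_contra hne
    rw [h, commonNeighbours_eq_empty hne] at hpos
    simp at hpos
  refine ⟨he', ?_⟩
  obtain ⟨j, hj⟩ := he'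
  have hc' := two_mul_card_commonNeighbours hn x' y' (i := j) (by omega)
  have l1 : hammingDist x y ≤ n := by simpa using hammingDist_le_card_fintype (x := x) (y := y)
  have l2 : hammingDist x' y' ≤ n := by
    simpa using hammingDist_le_card_fintype (x := x') (y := y')
  rcases centralBinom_mul_eq (p := p) (i := i) (j := j) (by omega) (by omega)
    (by rw [← hc, ← hc', h]) with h | h <;> omega

/-- An injective self-map of the finite set of pairs at distance `p` is onto, so no other pair can
land there. -/
lemma IsWeakIsometry.dist_iff {n p : ℕ} {φ : BoolCube n → BoolCube n}
    (hφ : IsWeakIsometry {p} φ) (x y : BoolCube n) :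
    hammingDist (φ x) (φ y) = p ↔ hammingDist x y = p := by
  refine ⟨fun h => ?_, hφ.2 p rfl x y⟩
  let f : {q : BoolCube n × BoolCube n // hammingDist q.1 q.2 = p} →
      {q : BoolCube n × BoolCube n // hammingDist q.1 q.2 = p} :=
    fun q => ⟨(φ q.1.1, φ q.1.2), hφ.2 p rfl _ _ q.2⟩
  have hf : Function.Injective f := by
    rintro ⟨⟨a, b⟩, _⟩ ⟨⟨c, d⟩, _⟩ h
    simp only [f, Subtype.mk.injEq, Prod.mk.injEq, hφ.1.1.eq_iff] at h
    simp [h]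
  obtain ⟨⟨⟨a, b⟩, hab⟩, hq⟩ := Finite.surjective_of_injective hf ⟨(φ x, φ y), h⟩
  simp only [f, Subtype.mk.injEq, Prod.mk.injEq, hφ.1.1.eq_iff] at hq
  rwa [← hq.1, ← hq.2]

lemma IsWeakIsometry.card_commonNeighbours {n p : ℕ} {φ : BoolCube n → BoolCube n}
    (hφ : IsWeakIsometry {p} φ) (x y : BoolCube n) :
    (commonNeighbours p (φ x) (φ y)).card = (commonNeighbours p x y).card := by
  symm
  refine Finset.card_bijective φ hφ.1 fun z => ?_
  simp [commonNeighbours, hφ.dist_iff]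

lemma IsWeakIsometry.even_dist_iff {n p : ℕ} (hn : n + 1 = 2 * p) {φ : BoolCube n → BoolCube n}
    (hφ : IsWeakIsometry {p} φ) (x y : BoolCube n) :
    Even (hammingDist (φ x) (φ y)) ↔ Even (hammingDist x y) :=
  ⟨fun h => (dist_of_card_commonNeighbours_eq hn (hφ.card_commonNeighbours x y) h).1,
    fun h => (dist_of_card_commonNeighbours_eq hn (hφ.card_commonNeighbours x y).symm h).1⟩

end Counting

/-! ### The folded cube and permutations of its `n + 1` coordinates -/

section FoldedCube

/-- The sign character of `ℤ/2`. -/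
def signChar (a : ZMod 2) : ℤ := if a = 0 then 1 else -1

lemma signChar_add (a b : ZMod 2) : signChar (a + b) = signChar a * signChar b := by
  revert a b; decide

lemma signChar_mul_self (a : ZMod 2) : signChar a * signChar a = 1 := by
  revert a; decide

lemma signChar_injective : Function.Injective signChar := by decide

lemma sum_signChar {ι : Type*} [Fintype ι] (u : ι → ZMod 2) :
    ∑ v, signChar (u v) = Fintype.card ι - 2 * hammingNorm u := by
  have : ∀ v, signChar (u v) = 1 - 2 * (if u v ≠ 0 then 1 else 0) := by
    intro v
    by_cases h : u v = 0 <;> simp [signChar, h]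
  simp only [this, Finset.sum_sub_distrib, ← Finset.mul_sum, Finset.sum_boole, hammingNorm]
  simp

/-- `n + 1 - 2 w`, where `w` is the weight of `x`. Its square is the invariant of the folded cube
of dimension `n + 1`. -/
def charSum {n : ℕ} (x : BoolCube n) : ℤ := n + 1 - 2 * hammingNorm x

/-- The word of `C_n` represented by a word with one more coordinate, `C_n` being identified with
the quotient of the `(n + 1)`-cube by the all-ones word. -/
def foldWord {n : ℕ} (u : Option (Fin n) → ZMod 2) : BoolCube n := fun k => u (some k) + u none

/-- The representative with zero extra coordinate. -/
def unfoldWord {n : ℕ} (x : BoolCube n) : Option (Fin n) → ZMod 2 := fun v => v.elim 0 x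

@[simp] lemma foldWord_unfoldWord {n : ℕ} (x : BoolCube n) : foldWord (unfoldWord x) = x := by
  funext k; simp [foldWord, unfoldWord]

lemma unfoldWord_foldWord {n : ℕ} (u : Option (Fin n) → ZMod 2) (v : Option (Fin n)) :
    unfoldWord (foldWord u) v = u v + u none := by
  cases v with
  | none => simp [unfoldWord, CharTwo.add_self_eq_zero]
  | some k => simp [unfoldWord, foldWord]

lemma unfoldWord_add {n : ℕ} (x y : BoolCube n) :
    unfoldWord (x + y) = unfoldWord x + unfoldWord y := by
  funext v; cases v <;> simp [unfoldWord]

lemma foldWord_add {n : ℕ} (u v : Option (Fin n) → ZMod 2) :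
    foldWord (u + v) = foldWord u + foldWord v := by
  funext k; simp only [foldWord, Pi.add_apply]; abel

@[simp] lemma foldWord_zero {n : ℕ} : foldWord (0 : Option (Fin n) → ZMod 2) = 0 := by
  funext k; simp [foldWord]

lemma charSum_eq_sum {n : ℕ} (x : BoolCube n) : charSum x = ∑ v, signChar (unfoldWord x v) := by
  rw [Fintype.sum_option]
  simp only [unfoldWord, Option.elim_none, Option.elim_some]
  rw [sum_signChar, charSum]
  simp [signChar]
  ring

lemma charSum_foldWord {n : ℕ} (u : Option (Fin n) → ZMod 2) :
    charSum (foldWord u) = signChar (u none) * ∑ v, signChar (u v) := by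
  simp only [charSum_eq_sum, unfoldWord_foldWord, signChar_add, ← Finset.sum_mul]
  ring

lemma charSum_foldWord_sq {n : ℕ} (u : Option (Fin n) → ZMod 2) :
    charSum (foldWord u) ^ 2 = (∑ v, signChar (u v)) ^ 2 := by
  rw [charSum_foldWord, mul_pow, sq (signChar _), signChar_mul_self, one_mul]

lemma charSum_sq_eq_iff {n : ℕ} (x y : BoolCube n) :
    charSum x ^ 2 = charSum y ^ 2 ↔
      hammingNorm x = hammingNorm y ∨ hammingNorm x + hammingNorm y = n + 1 := by
  rw [sq_eq_sq_iff_eq_or_eq_neg, charSum, charSum]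
  constructor
  · rintro (h | h) <;> omega
  · rintro (h | h) <;> omega

lemma even_norm_iff_of_charSum_sq_eq {n : ℕ} (hn : Even (n + 1)) {x y : BoolCube n}
    (h : charSum x ^ 2 = charSum y ^ 2) : Even (hammingNorm x) ↔ Even (hammingNorm y) := by
  rw [charSum_sq_eq_iff] at h
  rcases h with h | h
  · rw [h]
  · rw [← h, Nat.even_add] at hn
    exact hn

/-- The folded unit words: the `n` unit words and the all-ones word. -/
def foldUnit {n : ℕ} (a : Option (Fin n)) : BoolCube n := foldWord (Pi.single a 1)

/-- The map induced on `C_n` by a permutation of `n + 1` coordinates. -/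
def foldPerm {n : ℕ} (π : Equiv.Perm (Option (Fin n))) (x : BoolCube n) : BoolCube n :=
  foldWord fun v => unfoldWord x (π.symm v)

lemma foldPerm_foldWord {n : ℕ} (π : Equiv.Perm (Option (Fin n))) (u : Option (Fin n) → ZMod 2) :
    foldPerm π (foldWord u) = foldWord fun v => u (π.symm v) := by
  funext k
  simp only [foldPerm, unfoldWord_foldWord]
  simp only [foldWord]
  rw [add_add_add_comm, CharTwo.add_self_eq_zero, add_zero]

lemma foldPerm_add {n : ℕ} (π : Equiv.Perm (Option (Fin n))) (x y : BoolCube n) :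
    foldPerm π (x + y) = foldPerm π x + foldPerm π y := by
  rw [foldPerm, unfoldWord_add]
  exact foldWord_add _ _

lemma foldPerm_foldUnit {n : ℕ} (π : Equiv.Perm (Option (Fin n))) (a : Option (Fin n)) :
    foldPerm π (foldUnit a) = foldUnit (π a) := by
  rw [foldUnit, foldPerm_foldWord, foldUnit]
  congr 1
  funext v
  simp [Pi.single_apply, Equiv.symm_apply_eq]

lemma foldPerm_symm_foldPerm {n : ℕ} (π : Equiv.Perm (Option (Fin n))) (x : BoolCube n) :
    foldPerm π.symm (foldPerm π x) = x := by
  rw [foldPerm.eq_def π, foldPerm_foldWord]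
  simp

lemma foldPerm_bijective {n : ℕ} (π : Equiv.Perm (Option (Fin n))) :
    Function.Bijective (foldPerm π) :=
  Finite.injective_iff_bijective.1
    (Function.LeftInverse.injective (foldPerm_symm_foldPerm π))

lemma charSum_foldPerm_sq {n : ℕ} (π : Equiv.Perm (Option (Fin n))) (x : BoolCube n) :
    charSum (foldPerm π x) ^ 2 = charSum x ^ 2 := by
  rw [foldPerm, charSum_foldWord_sq, charSum_eq_sum,
    Equiv.sum_comp π.symm (fun v => signChar (unfoldWord x v))]

lemma foldPerm_isWeakIsometry {n p : ℕ} (hn : n + 1 = 2 * p) (π : Equiv.Perm (Option (Fin n))) :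
    IsWeakIsometry {p} (foldPerm π) := by
  refine ⟨foldPerm_bijective π, ?_⟩
  rintro _ rfl x y h
  rw [hammingDist_eq_norm_add] at h ⊢
  rw [← foldPerm_add]
  have := (charSum_sq_eq_iff _ _).1 (charSum_foldPerm_sq π (x + y))
  omega

/-- With the extra coordinate fixed, `charSum` is preserved with its sign, so weights are kept and
not merely folded weights. -/
lemma foldPerm_isCubeIsometry {n : ℕ} {π : Equiv.Perm (Option (Fin n))} (h : π none = none) :
    IsCubeIsometry (foldPerm π) := by
  refine ⟨foldPerm_bijective π, fun x y => ?_⟩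
  rw [hammingDist_eq_norm_add, hammingDist_eq_norm_add, ← foldPerm_add]
  have h1 : charSum (foldPerm π (x + y)) = charSum (x + y) := by
    rw [foldPerm, charSum_foldWord, charSum_eq_sum,
      Equiv.sum_comp π.symm (fun v => signChar (unfoldWord (x + y) v)),
      show π.symm none = none by rw [Equiv.symm_apply_eq, h]]
    simp [unfoldWord, signChar]
  simp only [charSum] at h1
  omega

/-- Here `j` is the image of the extra coordinate and `i` its preimage. Normalizing the extra
coordinate back to zero adds `c i` everywhere, which is the conditional complement in a
`σ_{i,j}`-mapping. -/
lemma foldPerm_isSigmaMapping {n : ℕ} {π : Equiv.Perm (Option (Fin n))} (h : π none ≠ none) :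
    IsSigmaMapping (foldPerm π) := by
  obtain ⟨j, hj⟩ := Option.ne_none_iff_exists'.1 h
  have h' : π.symm none ≠ none := fun h' =>
    h ((Equiv.symm_apply_eq π).1 h').symm
  obtain ⟨i, hi⟩ := Option.ne_none_iff_exists'.1 h'
  have hi' : π (some i) = none := by rw [← hi]; simp
  have hj' : π.symm (some j) = none := by rw [← hj]; simp
  have key1 : ∀ k : {k : Fin n // k ≠ i}, ∃ l : {k : Fin n // k ≠ j}, π (some k) = some l := by
    rintro ⟨k, hk⟩
    have h1 : π (some k) ≠ none := fun h1 => hk (by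
      have := π.injective (h1.trans hi'.symm); simpa using this)
    obtain ⟨l, hl⟩ := Option.ne_none_iff_exists'.1 h1
    refine ⟨⟨l, ?_⟩, hl⟩
    rintro rfl
    have := π.injective (hl.trans hj.symm)
    simp at this
  choose f hf using key1
  have hinj : Function.Injective f := by
    intro a b hab
    have : π (some (a : Fin n)) = π (some (b : Fin n)) := by rw [hf, hf, hab]
    exact Subtype.ext (by simpa using π.injective this)
  have hbij : Function.Bijective f := by
    rw [Fintype.bijective_iff_injective_and_card]
    exact ⟨hinj, by simp⟩
  let σ := Equiv.ofBijective f hbij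
  have hσ : ∀ k : {k : Fin n // k ≠ j}, π.symm (some (k : Fin n)) = some (σ.symm k : Fin n) := by
    intro k
    rw [Equiv.symm_apply_eq, hf]
    exact congrArg (fun l : {k : Fin n // k ≠ j} => some (l : Fin n)) (σ.apply_symm_apply k).symm
  refine ⟨i, j, σ, fun c => ?_⟩
  have e1 : ∀ k : {k : Fin n // k ≠ j}, foldPerm π c k = c (σ.symm k) + c i := by
    intro k
    simp [foldPerm, foldWord, hσ, hi, unfoldWord]
  have e2 : foldPerm π c j = c i := by
    simp [foldPerm, foldWord, hj', hi, unfoldWord]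
  refine ⟨fun hc => ⟨fun k => ?_, by rw [e2, hc]⟩, fun hc => ⟨fun k => ?_, by rw [e2, hc]⟩⟩
  · rw [e1, hc, add_zero]
  · rw [e1, hc]

/-- The permutation of `n + 1` coordinates behind a `σ_{i,j}`-mapping. -/
lemma IsSigmaMapping.exists_foldPerm {n : ℕ} {φ : BoolCube n → BoolCube n}
    (h : IsSigmaMapping φ) : ∃ π : Equiv.Perm (Option (Fin n)), φ = foldPerm π := by
  obtain ⟨i, j, σ, h⟩ := h
  -- This is the inverse of the wanted permutation, because `foldPerm` reads coordinates through
  -- `π.symm`.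
  let g : Option (Fin n) → Option (Fin n) := fun v =>
    v.elim (some i) fun k => if hk : k = j then none else some (σ.symm ⟨k, hk⟩ : Fin n)
  have hg : Function.Injective g := by
    rintro (_ | a) (_ | b) hab
    · rfl
    · by_cases hb : b = j
      · simp [g, hb] at hab
      · simp only [g, Option.elim_none, Option.elim_some, hb, dite_false, Option.some.injEq] at hab
        exact absurd hab.symm (σ.symm ⟨b, hb⟩).2
    · by_cases ha : a = j
      · simp [g, ha] at hab
      · simp only [g, Option.elim_none, Option.elim_some, ha, dite_false, Option.some.injEq] at hab
        exact absurd hab (σ.symm ⟨a, ha⟩).2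
    · by_cases ha : a = j <;> by_cases hb : b = j
      · rw [ha, hb]
      · simp [g, ha, hb] at hab
      · simp [g, ha, hb] at hab
      · simp only [g, Option.elim_some, ha, hb, dite_false, Option.some.injEq] at hab
        simpa using σ.symm.injective (Subtype.ext hab)
  refine ⟨(Equiv.ofBijective g (Finite.injective_iff_bijective.1 hg)).symm, ?_⟩
  have two : ∀ a : ZMod 2, a = 0 ∨ a = 1 := by decide
  funext c k
  have e : foldPerm (Equiv.ofBijective g (Finite.injective_iff_bijective.1 hg)).symm c k =
      unfoldWord c (g (some k)) + c i := rfl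
  rw [e]
  obtain ⟨h0, h1⟩ := h c
  by_cases hk : k = j
  · subst hk
    rcases two (c i) with hc | hc
    · simp [g, unfoldWord, hc, (h0 hc).2]
    · simp [g, unfoldWord, hc, (h1 hc).2]
  · rcases two (c i) with hc | hc
    · simp [g, unfoldWord, hc, hk, (h0 hc).1 ⟨k, hk⟩]
    · simp [g, unfoldWord, hc, hk, (h1 hc).1 ⟨k, hk⟩]

end FoldedCube

/-! ### Words of 2-subsets and how they determine a map -/

section Pairs

lemma sum_signChar_add_single {ι : Type*} [Fintype ι] [DecidableEq ι] (u : ι → ZMod 2) (a : ι) :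
    ∑ v, signChar ((u + Pi.single a 1 : ι → ZMod 2) v) =
      ∑ v, signChar (u v) - 2 * signChar (u a) := by
  have : ∀ v, signChar ((u + Pi.single a 1 : ι → ZMod 2) v) =
      signChar (u v) - if v = a then 2 * signChar (u a) else 0 := by
    intro v
    by_cases h : v = a
    · subst h
      simp [signChar_add, show signChar 1 = -1 by decide]
      ring
    · simp [h]
  simp only [this, Finset.sum_sub_distrib]
  simp

lemma charSum_foldWord_add_pair_sq {n : ℕ} (u : Option (Fin n) → ZMod 2) {a b : Option (Fin n)}
    (hab : a ≠ b) :
    charSum (foldWord u + (foldUnit a + foldUnit b)) ^ 2 =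
      (∑ v, signChar (u v) - 2 * signChar (u a) - 2 * signChar (u b)) ^ 2 := by
  rw [← add_assoc, foldUnit, foldUnit, ← foldWord_add, ← foldWord_add, charSum_foldWord_sq,
    sum_signChar_add_single, sum_signChar_add_single]
  simp [hab.symm]

lemma charSum_pair_sq {n : ℕ} {a b : Option (Fin n)} (hab : a ≠ b) :
    charSum (foldUnit a + foldUnit b) ^ 2 = (n - 3 : ℤ) ^ 2 := by
  have := charSum_foldWord_add_pair_sq 0 hab
  rw [foldWord_zero, zero_add] at this
  rw [this]
  simp [signChar]
  ring

/-- Separates disjoint 2-subsets from those sharing one point, whose value is `(n - 3)²`; the two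
values agree only at `n = 5`. -/
lemma charSum_pair_add_pair_sq {n : ℕ} {a b c d : Option (Fin n)} (hab : a ≠ b) (hac : a ≠ c)
    (had : a ≠ d) (hbc : b ≠ c) (hbd : b ≠ d) (hcd : c ≠ d) :
    charSum (foldUnit a + foldUnit b + (foldUnit c + foldUnit d)) ^ 2 = (n - 7 : ℤ) ^ 2 := by
  have := charSum_foldWord_add_pair_sq (Pi.single a 1 + Pi.single b 1) hcd
  rw [foldWord_add] at this
  rw [foldUnit, foldUnit, this, sum_signChar_add_single]
  have h0 := sum_signChar_add_single (0 : Option (Fin n) → ZMod 2) a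
  rw [zero_add] at h0
  rw [h0]
  simp [hac.symm, had.symm, hbc.symm, hbd.symm, hab.symm, show signChar 0 = 1 by decide]
  ring

lemma charSum_zero {n : ℕ} : charSum (0 : BoolCube n) = n + 1 := by simp [charSum]

/-- The two representatives of `x` are complementary and have opposite sign sums, so one of them has
sum `S`. -/
lemma exists_foldWord_eq {n : ℕ} {x : BoolCube n} {S : ℤ} (h : charSum x ^ 2 = S ^ 2) :
    ∃ u, foldWord u = x ∧ ∑ v, signChar (u v) = S := by
  rcases sq_eq_sq_iff_eq_or_eq_neg.1 h with h | h
  · exact ⟨unfoldWord x, foldWord_unfoldWord x, by rw [← charSum_eq_sum, h]⟩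
  · refine ⟨unfoldWord x + 1, ?_, ?_⟩
    · rw [foldWord_add, foldWord_unfoldWord, show foldWord (1 : Option (Fin n) → ZMod 2) = 0 by
        funext k; simp [foldWord, CharTwo.add_self_eq_zero], add_zero]
    · simp only [Pi.add_apply, Pi.one_apply, signChar_add, ← Finset.sum_mul, ← charSum_eq_sum, h,
        show signChar 1 = -1 by decide]
      ring

lemma exists_foldUnit_eq {n : ℕ} {x : BoolCube n} (h : charSum x ^ 2 = (n - 1 : ℤ) ^ 2) :
    ∃ a, x = foldUnit a := by
  obtain ⟨u, rfl, hu⟩ := exists_foldWord_eq h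
  rw [sum_signChar, Fintype.card_option, Fintype.card_fin] at hu
  have hu1 : hammingNorm u = 1 := by push_cast at hu; omega
  obtain ⟨a, ha⟩ := Finset.card_eq_one.1 hu1
  refine ⟨a, congrArg foldWord (funext fun v => ?_)⟩
  have one : ∀ t : ZMod 2, t ≠ 0 → t = 1 := by decide
  have hv := Finset.ext_iff.1 ha v
  simp only [Finset.mem_filter, Finset.mem_univ, true_and, Finset.mem_singleton] at hv
  by_cases h : v = a
  · rw [one _ (hv.2 h), h, Pi.single_eq_same]
  · rw [Pi.single_eq_of_ne h]
    exact not_not.1 fun h' => h (hv.1 h')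

lemma exists_pair_eq {n : ℕ} {x : BoolCube n} (h : charSum x ^ 2 = (n - 3 : ℤ) ^ 2) :
    ∃ a b, a ≠ b ∧ x = foldUnit a + foldUnit b := by
  obtain ⟨u, rfl, hu⟩ := exists_foldWord_eq h
  rw [sum_signChar, Fintype.card_option, Fintype.card_fin] at hu
  have hu1 : hammingNorm u = 2 := by push_cast at hu; omega
  obtain ⟨a, b, hab, ha⟩ := Finset.card_eq_two.1 hu1
  refine ⟨a, b, hab, ?_⟩
  rw [foldUnit, foldUnit, ← foldWord_add]
  refine congrArg foldWord (funext fun v => ?_)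
  have one : ∀ t : ZMod 2, t ≠ 0 → t = 1 := by decide
  have hv := Finset.ext_iff.1 ha v
  simp only [Finset.mem_filter, Finset.mem_univ, true_and, Finset.mem_insert,
    Finset.mem_singleton] at hv
  by_cases h : v = a
  · subst h
    simp [one _ (hv.2 (Or.inl rfl)), hab]
  · by_cases h' : v = b
    · subst h'
      simp [one _ (hv.2 (Or.inr rfl)), h]
    · have : u v = 0 := not_not.1 fun h'' => (hv.1 h'').elim h h'
      simp [this, h, h']

lemma even_norm_pair {n : ℕ} (hn : Even (n + 1)) (a b : Option (Fin n)) :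
    Even (hammingNorm (foldUnit a + foldUnit b)) := by
  by_cases hab : a = b
  · subst hab; simp [cube_add_self]
  · have h := charSum_pair_sq hab
    rw [charSum, sq_eq_sq_iff_eq_or_eq_neg] at h
    rw [Nat.even_iff] at *
    omega

lemma foldUnit_add_add_cancel {n : ℕ} (a b c : Option (Fin n)) :
    foldUnit a + foldUnit b + (foldUnit a + foldUnit c) = foldUnit b + foldUnit c := by
  rw [add_add_add_comm, cube_add_self, zero_add]

/-- Two 2-subsets whose words are at folded distance two share exactly one element. -/
lemma pair_meets {n : ℕ} (hn : 7 ≤ n) {a b c d : Option (Fin n)} (hab : a ≠ b) (hcd : c ≠ d)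
    (h : charSum (foldUnit a + foldUnit b + (foldUnit c + foldUnit d)) ^ 2 = (n - 3 : ℤ) ^ 2) :
    (a = c ∧ b ≠ d) ∨ (a = d ∧ b ≠ c) ∨ (b = c ∧ a ≠ d) ∨ (b = d ∧ a ≠ c) := by
  have h0 : foldUnit a + foldUnit b ≠ foldUnit c + foldUnit d := by
    intro h'
    rw [h', cube_add_self, charSum_zero, sq_eq_sq_iff_eq_or_eq_neg] at h
    omega
  have h1 : ¬ (a = c ∧ b = d) := by rintro ⟨rfl, rfl⟩; exact h0 rfl
  have h2 : ¬ (a = d ∧ b = c) := by rintro ⟨rfl, rfl⟩; exact h0 (add_comm _ _)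
  have h3 : ¬ (a ≠ c ∧ a ≠ d ∧ b ≠ c ∧ b ≠ d) := by
    rintro ⟨h3, h4, h5, h6⟩
    rw [charSum_pair_add_pair_sq hab h3 h4 h5 h6 hcd, sq_eq_sq_iff_eq_or_eq_neg] at h
    omega
  tauto

lemma pair_eq_pair {n : ℕ} (hn : 5 ≤ n) {a b c d : Option (Fin n)} (hab : a ≠ b)
    (h : foldUnit a + foldUnit b = foldUnit c + foldUnit d) :
    (a = c ∧ b = d) ∨ (a = d ∧ b = c) := by
  have inj : ∀ {e f : Option (Fin n)}, foldUnit e + foldUnit f = 0 → e = f := by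
    intro e f hef
    by_contra hne
    have := charSum_pair_sq hne
    rw [hef, charSum_zero, sq_eq_sq_iff_eq_or_eq_neg] at this
    omega
  have hcd : c ≠ d := by
    rintro rfl
    rw [cube_add_self] at h
    exact hab (inj h)
  have h0 : foldUnit a + foldUnit b + (foldUnit c + foldUnit d) = 0 := by rw [h, cube_add_self]
  by_cases h1 : a = c
  · subst h1
    rw [foldUnit_add_add_cancel] at h0
    exact Or.inl ⟨rfl, inj h0⟩
  by_cases h2 : a = d
  · subst h2
    rw [add_comm (foldUnit c), foldUnit_add_add_cancel] at h0
    exact Or.inr ⟨rfl, inj h0⟩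
  by_cases h3 : b = c
  · subst h3
    rw [add_comm (foldUnit a), foldUnit_add_add_cancel] at h0
    exact absurd (inj h0) h2
  by_cases h4 : b = d
  · subst h4
    rw [add_comm (foldUnit a), add_comm (foldUnit c), foldUnit_add_add_cancel] at h0
    exact absurd (inj h0) h1
  have := charSum_pair_add_pair_sq hab h1 h2 h3 h4 hcd
  rw [h0, charSum_zero, sq_eq_sq_iff_eq_or_eq_neg] at this
  omega

/-- A word is determined by its folded distances to `0` and to the words of the 2-subsets. -/
lemma eq_of_charSum_pair_sq_eq {n : ℕ} (hn : n ≠ 3) {x y : BoolCube n}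
    (h : charSum x ^ 2 = charSum y ^ 2)
    (hp : ∀ a b, a ≠ b → charSum (x + (foldUnit a + foldUnit b)) ^ 2 =
      charSum (y + (foldUnit a + foldUnit b)) ^ 2) : x = y := by
  obtain ⟨u, rfl, hu⟩ := exists_foldWord_eq (x := x) (S := charSum y) h
  obtain ⟨v, rfl, hv⟩ := exists_foldWord_eq (x := y) (S := charSum y) rfl
  generalize charSum (foldWord v) = S at *
  -- Expand the squares of `S - 2s - 2t` with signs `s`, `t`, and cancel the common terms.
  have key : ∀ a b, a ≠ b → S * (signChar (u a) + signChar (u b)) -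
      2 * (signChar (u a) * signChar (u b)) = S * (signChar (v a) + signChar (v b)) -
      2 * (signChar (v a) * signChar (v b)) := by
    intro a b hab
    have := hp a b hab
    rw [charSum_foldWord_add_pair_sq _ hab, charSum_foldWord_add_pair_sq _ hab, hu, hv] at this
    have h1 := signChar_mul_self (u a)
    have h2 := signChar_mul_self (u b)
    have h3 := signChar_mul_self (v a)
    have h4 := signChar_mul_self (v b)
    linarith
  funext k
  apply signChar_injective
  simp only [foldWord, signChar_add]
  -- For `S = 0` only products of signs are known, but those with the extra coordinate are exactly
  -- the signs of the folded word.
  by_cases hS : S = 0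
  · have := key (some k) none (by simp)
    rw [hS] at this
    linarith
  · have heq : ∀ a, signChar (u a) = signChar (v a) := by
      intro a
      -- Summing `key` over all `b` leaves only the term `b = a`, giving `S (n - 3) (signChar (u a)
      -- - signChar (v a)) = 0`.
      have hsum : ∑ b, (S * (signChar (u a) + signChar (u b)) -
          2 * (signChar (u a) * signChar (u b)) - (S * (signChar (v a) + signChar (v b)) -
          2 * (signChar (v a) * signChar (v b)))) = S * (signChar (u a) + signChar (u a)) -
          2 * (signChar (u a) * signChar (u a)) - (S * (signChar (v a) + signChar (v a)) -
          2 * (signChar (v a) * signChar (v a))) := by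
        refine Finset.sum_eq_single a (fun b _ hb => ?_) (by simp)
        rw [key a b hb.symm, sub_self]
      simp only [Finset.sum_sub_distrib, ← Finset.mul_sum, Finset.sum_add_distrib, hu, hv,
        signChar_mul_self, Finset.sum_const, Finset.card_univ, Fintype.card_option,
        Fintype.card_fin, nsmul_eq_mul] at hsum
      push_cast at hsum
      have : S * ((n - 3 : ℤ) * (signChar (u a) - signChar (v a))) = 0 := by linarith
      rcases mul_eq_zero.1 ((mul_eq_zero.1 this).resolve_left hS) with h' | h'
      · omega
      · omega
    rw [heq, heq]

/-- At least four 2-sets that pairwise share exactly one element have a common element. -/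
lemma exists_common_element {ι V : Type*} (A B : ι → V) (hAB : ∀ k, A k ≠ B k)
    (hcard : ∀ a b c : ι, ∃ d, d ≠ a ∧ d ≠ b ∧ d ≠ c)
    (h : ∀ k l, k ≠ l → (A k = A l ∧ B k ≠ B l) ∨ (A k = B l ∧ B k ≠ A l) ∨
      (B k = A l ∧ A k ≠ B l) ∨ (B k = B l ∧ A k ≠ A l)) [Nonempty ι] :
    ∃ v, ∀ k, v = A k ∨ v = B k := by
  obtain ⟨i⟩ := ‹Nonempty ι›
  obtain ⟨j, hj, -, -⟩ := hcard i i i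
  obtain ⟨v, b, c, hbc, hi, hj'⟩ : ∃ v b c, b ≠ c ∧ ((A i = v ∧ B i = b) ∨ (A i = b ∧ B i = v)) ∧
      ((A j = v ∧ B j = c) ∨ (A j = c ∧ B j = v)) := by
    rcases h i j hj.symm with h | h | h | h
    · exact ⟨A i, B i, B j, h.2, by tauto, by rw [h.1]; tauto⟩
    · exact ⟨A i, B i, A j, h.2, by tauto, by rw [h.1]; tauto⟩
    · exact ⟨B i, A i, B j, h.2, by tauto, by rw [h.1]; tauto⟩
    · exact ⟨B i, A i, A j, h.2, by tauto, by rw [h.1]; tauto⟩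
  refine ⟨v, fun k => ?_⟩
  by_contra hk
  have hki : k ≠ i := by rintro rfl; tauto
  have hkj : k ≠ j := by rintro rfl; tauto
  -- A set missing `v` must be `{b, c}`, closing a triangle; no fourth 2-set meets all three sides
  -- in exactly one point each.
  obtain ⟨l, hli, hlj, hlk⟩ := hcard i j k
  have h1 := h k i hki
  have h2 := h k j hkj
  have h3 := h l i hli
  have h4 := h l j hlj
  have h5 := h l k hlk
  have h6 := hAB k
  have h7 := hAB l
  have h8 := hAB i
  have h9 := hAB j
  grind

/-- A map fixing `0` and preserving folded even distances permutes the words of the 2-subsets by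
a permutation of the `n + 1` coordinates. -/
lemma exists_perm_of_pairs {n : ℕ} (hn : 7 ≤ n) (hodd : Even (n + 1))
    {φ : BoolCube n → BoolCube n} (hinj : Function.Injective φ) (h0 : φ 0 = 0)
    (hQ : ∀ x y, Even (hammingNorm x) → Even (hammingNorm y) →
      charSum (φ x + φ y) ^ 2 = charSum (x + y) ^ 2) :
    ∃ π : Equiv.Perm (Option (Fin n)), ∀ a b,
      φ (foldUnit a + foldUnit b) = foldUnit (π a) + foldUnit (π b) := by
  have hex : ∀ a b : Option (Fin n), a ≠ b →
      ∃ c d, c ≠ d ∧ φ (foldUnit a + foldUnit b) = foldUnit c + foldUnit d := by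
    intro a b hab
    apply exists_pair_eq
    have := hQ _ 0 (even_norm_pair hodd a b) (by simp)
    rwa [h0, add_zero, add_zero, charSum_pair_sq hab] at this
  have hmeet : ∀ a b c : Option (Fin n), b ≠ c →
      charSum (φ (foldUnit a + foldUnit b) + φ (foldUnit a + foldUnit c)) ^ 2 =
        (n - 3 : ℤ) ^ 2 := by
    intro a b c hbc
    rw [hQ _ _ (even_norm_pair hodd _ _) (even_norm_pair hodd _ _), foldUnit_add_add_cancel,
      charSum_pair_sq hbc]
  choose A B hAB hφ using fun k : Fin n => hex none (some k) (by simp)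
  have : Nonempty (Fin n) := ⟨⟨0, by omega⟩⟩
  obtain ⟨v, hv⟩ := exists_common_element A B hAB (by
      intro a b c
      obtain ⟨d, hd⟩ := Finset.exists_mem_notMem_of_card_lt_card
        (s := ({a, b, c} : Finset (Fin n))) (t := Finset.univ)
        (Finset.card_le_three.trans_lt (by simp; omega))
      simp only [Finset.mem_insert, Finset.mem_singleton, not_or] at hd
      exact ⟨d, hd.2⟩) (by
      intro k l hkl
      apply pair_meets hn (hAB k) (hAB l)
      rw [← hφ, ← hφ]
      exact hmeet _ _ _ (by simpa using hkl))
  have hf : ∀ k, ∃ c, v ≠ c ∧ φ (foldUnit none + foldUnit (some k)) = foldUnit v + foldUnit c := by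
    intro k
    rcases hv k with h | h
    · exact ⟨B k, h ▸ hAB k, by rw [hφ, h]⟩
    · exact ⟨A k, h ▸ (hAB k).symm, by rw [hφ, h, add_comm]⟩
  choose f hvf hf using hf
  have hfinj : Function.Injective f := by
    intro k l hkl
    have := hinj ((hf k).trans ((congrArg _ (congrArg _ hkl)).trans (hf l).symm))
    rcases pair_eq_pair (by omega) (by simp) this with h | h
    · simpa using h.2
    · simp at h
  let g : Option (Fin n) → Option (Fin n) := fun a => a.elim v f
  have hg : Function.Injective g := by
    rintro (_ | a) (_ | b) hab
    · rfl
    · exact absurd hab (hvf b)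
    · exact absurd hab.symm (hvf a)
    · exact congrArg some (hfinj hab)
  have hgb := Finite.injective_iff_bijective.1 hg
  have hpair : ∀ j k, j ≠ k → φ (foldUnit (some j) + foldUnit (some k)) =
      foldUnit (f j) + foldUnit (f k) := by
    intro j k hjk
    obtain ⟨c, d, hcd, he⟩ := hex (some j) (some k) (by simpa using hjk)
    -- The pairs through `v` are already the images of the pairs through `none`. So the image of
    -- `{j, k}` avoids `v`, and meeting `{v, f j}` and `{v, f k}` it must be `{f j, f k}`.
    have hv' : ∀ e, v ≠ e → φ (foldUnit (some j) + foldUnit (some k)) ≠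
        foldUnit v + foldUnit e := by
      intro e hve h
      obtain ⟨l, hl⟩ := hgb.2 e
      cases l with
      | none => exact hve hl
      | some l =>
        have hl' : f l = e := hl
        rw [← hl', ← hf] at h
        rcases pair_eq_pair (by omega) (by simpa using hjk) (hinj h) with h | h <;> simp at h
    have hvc : v ≠ c := by
      rintro rfl
      exact hv' d hcd he
    have hvd : v ≠ d := by
      rintro rfl
      exact hv' c hcd.symm (by rw [he, add_comm])
    have m1 := hmeet (some j) (some k) none (by simp)
    have m2 := hmeet (some k) (some j) none (by simp)
    rw [he, add_comm (foldUnit _) (foldUnit none), hf] at m1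
    rw [add_comm (foldUnit (some k)), he, add_comm (foldUnit _) (foldUnit none), hf] at m2
    have m1 := pair_meets hn hcd (hvf j) m1
    have m2 := pair_meets hn hcd (hvf k) m2
    have hne : f j ≠ f k := fun h => hjk (hfinj h)
    have : (c = f j ∧ d = f k) ∨ (c = f k ∧ d = f j) := by grind
    rcases this with ⟨rfl, rfl⟩ | ⟨rfl, rfl⟩
    · exact he
    · rw [he, add_comm]
  refine ⟨Equiv.ofBijective g hgb, ?_⟩
  rintro (_ | a) (_ | b)
  · simp [cube_add_self, h0]
  · exact hf b
  · rw [add_comm, hf a]; exact add_comm _ _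
  · by_cases hab : a = b
    · subst hab; simp [cube_add_self, h0]
    · exact hpair a b hab

end Pairs

/-! ### The action on even words and on odd words -/

section Classification

lemma IsWeakIsometry.charSum_sq {n p : ℕ} (hn : n + 1 = 2 * p) {φ : BoolCube n → BoolCube n}
    (hφ : IsWeakIsometry {p} φ) (x y : BoolCube n) (hx : Even (hammingNorm x))
    (hy : Even (hammingNorm y)) : charSum (φ x + φ y) ^ 2 = charSum (x + y) ^ 2 := by
  have he : Even (hammingDist x y) := by rw [even_hammingDist]; tauto
  have := (dist_of_card_commonNeighbours_eq hn (hφ.card_commonNeighbours x y).symm he).2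
  rw [charSum_sq_eq_iff, ← hammingDist_eq_norm_add, ← hammingDist_eq_norm_add]
  exact this

lemma eq_foldPerm_of_pairs {n : ℕ} (hn : n ≠ 3) (hodd : Even (n + 1))
    {φ : BoolCube n → BoolCube n} (h0 : φ 0 = 0)
    (hQ : ∀ x y, Even (hammingNorm x) → Even (hammingNorm y) →
      charSum (φ x + φ y) ^ 2 = charSum (x + y) ^ 2)
    (π : Equiv.Perm (Option (Fin n)))
    (hπ : ∀ a b, φ (foldUnit a + foldUnit b) = foldUnit (π a) + foldUnit (π b))
    {x : BoolCube n} (hx : Even (hammingNorm x)) : φ x = foldPerm π x := by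
  refine eq_of_charSum_pair_sq_eq hn ?_ fun a b _ => ?_
  · have := hQ x 0 hx (by simp)
    rwa [h0, add_zero, add_zero, ← charSum_foldPerm_sq π x] at this
  · have h1 := hQ x (foldUnit (π.symm a) + foldUnit (π.symm b)) hx (even_norm_pair hodd _ _)
    rw [← charSum_foldPerm_sq π (x + _), hπ, foldPerm_add, foldPerm_add, foldPerm_foldUnit,
      foldPerm_foldUnit] at h1
    simpa using h1

/-- For `n = 5` the even distances 2 and 4 fold together and carry no information. But odd distances
other than 3 are 1 and 5, that is, folded distance one; so `φ` permutes the folded units, and this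
gives `π`. -/
lemma exists_perm_of_pairs_five {φ : BoolCube 5 → BoolCube 5} (hφ : IsWeakIsometry {3} φ)
    (h0 : φ 0 = 0) :
    ∃ π : Equiv.Perm (Option (Fin 5)), ∀ a b,
      φ (foldUnit a + foldUnit b) = foldUnit (π a) + foldUnit (π b) := by
  have hnorm : ∀ x : BoolCube 5, charSum x ^ 2 = (5 - 1) ^ 2 ↔
      ¬ Even (hammingNorm x) ∧ hammingNorm x ≠ 3 := by
    intro x
    have hle : hammingNorm x ≤ 5 := by simpa using hammingNorm_le_card_fintype (x := x)
    rw [charSum, sq_eq_sq_iff_eq_or_eq_neg, Nat.even_iff]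
    push_cast
    omega
  have hQ : ∀ x y, charSum (φ x + φ y) ^ 2 = (5 - 1) ^ 2 ↔ charSum (x + y) ^ 2 = (5 - 1) ^ 2 := by
    intro x y
    rw [hnorm, hnorm, ← hammingDist_eq_norm_add, ← hammingDist_eq_norm_add,
      hφ.even_dist_iff (by norm_num), ne_eq, hφ.dist_iff]
  have hunit : ∀ a : Option (Fin 5), charSum (foldUnit a) ^ 2 = (5 - 1) ^ 2 := by
    intro a
    have h := sum_signChar_add_single (0 : Option (Fin 5) → ZMod 2) a
    rw [zero_add] at h
    rw [foldUnit, charSum_foldWord_sq, h]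
    simp [signChar]
  have hex : ∀ a : Option (Fin 5), ∃ b, φ (foldUnit a) = foldUnit b := by
    intro a
    apply exists_foldUnit_eq
    have := hQ (foldUnit a) 0
    rw [h0, add_zero, add_zero] at this
    exact this.2 (hunit a)
  choose g hg using hex
  have hpair : ∀ {a b : Option (Fin 5)}, a ≠ b → foldUnit a + foldUnit b ≠ 0 := by
    intro a b hab h
    have := charSum_pair_sq hab
    rw [h, charSum_zero] at this
    norm_num at this
  have hginj : Function.Injective g := by
    intro a b hab
    by_contra hne
    have : foldUnit a = foldUnit b := hφ.1.1 (by rw [hg, hg, hab])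
    exact hpair hne (by rw [this, cube_add_self])
  have hnear : ∀ a b, ∃ c, φ (foldUnit a + foldUnit b) = foldUnit (g a) + foldUnit c := by
    intro a b
    have h := (hQ (foldUnit a) (foldUnit a + foldUnit b)).2 (by
      rw [← add_assoc, cube_add_self, zero_add]; exact hunit b)
    obtain ⟨c, hc⟩ := exists_foldUnit_eq h
    refine ⟨c, ?_⟩
    rw [← hc, ← hg, ← add_assoc, cube_add_self, zero_add]
  refine ⟨Equiv.ofBijective g (Finite.injective_iff_bijective.1 hginj), fun a b => ?_⟩
  change _ = foldUnit (g a) + foldUnit (g b)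
  by_cases hab : a = b
  · subst hab; rw [cube_add_self, cube_add_self, h0]
  obtain ⟨c, hc⟩ := hnear a b
  obtain ⟨d, hd⟩ := hnear b a
  rw [add_comm (foldUnit b)] at hd
  have hne : g a ≠ c := by
    rintro rfl
    rw [cube_add_self, ← h0] at hc
    exact hpair hab (hφ.1.1 hc)
  rcases pair_eq_pair le_rfl hne (hc.symm.trans hd) with h | h
  · exact absurd (hginj h.1) hab
  · rw [hc, h.2]

/-- A `p`-isometry fixing `0` acts on the words of even weight as a permutation of `n + 1 = 2p`
coordinates. -/
lemma IsWeakIsometry.exists_foldPerm_even {n p : ℕ} (hn : n + 1 = 2 * p) (hp : 3 ≤ p)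
    {φ : BoolCube n → BoolCube n} (hφ : IsWeakIsometry {p} φ) (h0 : φ 0 = 0) :
    ∃ π : Equiv.Perm (Option (Fin n)), ∀ x, Even (hammingNorm x) → φ x = foldPerm π x := by
  have hodd : Even (n + 1) := by rw [hn]; exact even_two_mul p
  obtain ⟨π, hπ⟩ : ∃ π : Equiv.Perm (Option (Fin n)), ∀ a b,
      φ (foldUnit a + foldUnit b) = foldUnit (π a) + foldUnit (π b) := by
    rcases hp.eq_or_lt with rfl | hp
    · obtain rfl : n = 5 := by omega
      exact exists_perm_of_pairs_five hφ h0
    · exact exists_perm_of_pairs (by omega) hodd hφ.1.1 h0 (hφ.charSum_sq hn)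
  exact ⟨π, fun x hx => eq_foldPerm_of_pairs (by omega) hodd h0 (hφ.charSum_sq hn) π hπ hx⟩

/-- For odd `p`, a `p`-isometry is determined by its values on the words of even weight. -/
lemma IsWeakIsometry.eq_of_eqOn_even {n p : ℕ} (hn : n + 1 = 2 * p) (hp : ¬ Even p)
    {φ ψ : BoolCube n → BoolCube n} (hφ : IsWeakIsometry {p} φ) (hψ : IsWeakIsometry {p} ψ)
    (h : ∀ x, Even (hammingNorm x) → φ x = ψ x) : φ = ψ := by
  funext y
  by_cases hy : Even (hammingNorm y)
  · exact h y hy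
  have hz : ∀ z, hammingDist y z = p → φ z = ψ z := by
    intro z hyz
    apply h
    have := even_hammingDist y z
    rw [hyz] at this
    tauto
  -- As `p` is odd, every word at distance `p` from the odd word `y` is even, where `φ` and `ψ`
  -- agree. So `φ y` and `ψ y` have as many common neighbours as `φ y` with itself, leaving distance
  -- 0 or the impossible `n + 1`.
  have hsub : commonNeighbours p (φ y) (φ y) ⊆ commonNeighbours p (φ y) (ψ y) := by
    intro w hw
    obtain ⟨z, rfl⟩ := hφ.1.2 w
    simp only [commonNeighbours, Finset.mem_filter, Finset.mem_univ, true_and, and_self] at hw ⊢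
    refine ⟨hw, ?_⟩
    have hyz := (hφ.dist_iff y z).1 hw
    rw [hz z hyz]
    exact hψ.2 p rfl y z hyz
  have hsub' : commonNeighbours p (φ y) (ψ y) ⊆ commonNeighbours p (φ y) (φ y) := by
    intro w hw
    simp only [commonNeighbours, Finset.mem_filter, Finset.mem_univ, true_and] at hw ⊢
    tauto
  have := (dist_of_card_commonNeighbours_eq hn (congrArg Finset.card (hsub.antisymm hsub'))
    (by simp)).2
  have hle : hammingDist (φ y) (ψ y) ≤ n := by
    simpa using hammingDist_le_card_fintype (x := φ y) (y := ψ y)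
  rw [hammingDist_self] at this
  exact hammingDist_eq_zero.1 (by omega)

lemma IsWeakIsometry.even_norm_iff {n p : ℕ} (hn : n + 1 = 2 * p) {φ : BoolCube n → BoolCube n}
    (hφ : IsWeakIsometry {p} φ) (h0 : φ 0 = 0) (x : BoolCube n) :
    Even (hammingNorm (φ x)) ↔ Even (hammingNorm x) := by
  have := hφ.even_dist_iff hn x 0
  rwa [h0, hammingDist_zero_right, hammingDist_zero_right] at this

/-- A `p`-isometry fixing `0` acts on the words of odd weight as a permutation of `n + 1 = 2p`
coordinates followed by an even translation. -/
lemma IsWeakIsometry.exists_foldPerm_odd {n p : ℕ} (hn : n + 1 = 2 * p) (hp : 3 ≤ p)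
    {φ : BoolCube n → BoolCube n} (hφ : IsWeakIsometry {p} φ) (h0 : φ 0 = 0) :
    ∃ (π : Equiv.Perm (Option (Fin n))) (a : BoolCube n), Even (hammingNorm a) ∧
      ∀ x, ¬ Even (hammingNorm x) → φ x = foldPerm π x + a := by
  have hodd : Even (n + 1) := by rw [hn]; exact even_two_mul p
  obtain ⟨e, he⟩ : ∃ e : BoolCube n, ¬ Even (hammingNorm e) := by
    refine ⟨fun _ => 1, ?_⟩
    have : hammingNorm (fun _ => 1 : BoolCube n) = n := by simp [hammingNorm]
    rw [this]
    exact Nat.even_add_one.1 hodd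
  -- Translating by the odd word `e` carries `O` to `E` and restores the fixed origin.
  have hφ' : IsWeakIsometry {p} fun x => φ (x + e) + φ e := by
    refine ⟨Finite.injective_iff_bijective.1 fun x y h => ?_, ?_⟩
    · exact add_right_cancel (hφ.1.1 (add_right_cancel h))
    · intro q hq x y h
      rw [hammingDist_add_right]
      exact hφ.2 q hq _ _ (by rw [hammingDist_add_right, h])
  obtain ⟨π, hπ⟩ := hφ'.exists_foldPerm_even hn hp (by simp [cube_add_self])
  refine ⟨π, foldPerm π e + φ e, ?_, fun x hx => ?_⟩
  · have h1 := even_norm_iff_of_charSum_sq_eq hodd (charSum_foldPerm_sq π e)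
    have h2 := hφ.even_norm_iff hn h0 e
    rw [even_hammingNorm_add]
    tauto
  · have := hπ (x + e) (by rw [even_hammingNorm_add]; tauto)
    simp only [cube_add_add_cancel] at this
    rw [← add_assoc, ← foldPerm_add, ← this, cube_add_add_cancel]

lemma IsCubeIsometry.isEvenIsometry {n : ℕ} {φ : BoolCube n → BoolCube n}
    (h : IsCubeIsometry φ) : IsEvenIsometry φ :=
  ⟨h.1, fun p _ x y hxy => by rw [h.2, hxy]⟩

lemma IsCubeIsometry.add_right {n : ℕ} {φ : BoolCube n → BoolCube n}
    (h : IsCubeIsometry φ) (a : BoolCube n) : IsCubeIsometry fun x => φ x + a :=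
  ⟨Finite.injective_iff_bijective.1 fun _ _ hxy => h.1.1 (add_right_cancel hxy),
    fun x y => by rw [hammingDist_add_right, h.2]⟩

lemma isCubeIsometry_of_length_one {φ : BoolCube 1 → BoolCube 1} (h : Function.Bijective φ) :
    IsCubeIsometry φ := by
  refine ⟨h, fun x y => ?_⟩
  have h1 : hammingDist x y ≤ 1 := by simpa using hammingDist_le_card_fintype (x := x) (y := y)
  have h2 : hammingDist (φ x) (φ y) ≤ 1 := by
    simpa using hammingDist_le_card_fintype (x := φ x) (y := φ y)
  have h3 : hammingDist (φ x) (φ y) = 0 ↔ hammingDist x y = 0 := by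
    rw [hammingDist_eq_zero, hammingDist_eq_zero, h.1.eq_iff]
  omega

end Classification

/-! ### Assembling the two residue classes -/

theorem mainTheorem3 (n : ℕ) :
    (n ≡ 1 [MOD 4] →
      (∀ φ : BoolCube n → BoolCube n, IsWeakIsometry {(n + 1) / 2} φ → φ 0 = 0 →
        ¬ IsCubeIsometry φ → IsSigmaMapping φ) ∧
      (∀ φ : BoolCube n → BoolCube n, IsSigmaMapping φ → IsWeakIsometry {(n + 1) / 2} φ)) ∧
    (n ≡ 3 [MOD 4] →
      ∀ φ : BoolCube n → BoolCube n, IsWeakIsometry {(n + 1) / 2} φ → φ 0 = 0 →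
        ¬ IsEvenIsometry φ →
        (∃ (τ : BoolCube n → BoolCube n) (a : BoolCube n),
          IsSigmaMapping τ ∧ a ∈ evenWords n ∧
          ActsAsEvenIsometryOn φ (evenWords n) ∧
          Set.EqOn φ (cubeTranslation a ∘ τ) (oddWords n)) ∨
        (∃ τ : BoolCube n → BoolCube n,
          IsSigmaMapping τ ∧
          Set.EqOn φ τ (evenWords n) ∧
          ActsAsEvenIsometryOn φ (oddWords n)) ∨
        (∃ (τ₁ τ₂ : BoolCube n → BoolCube n) (a : BoolCube n),
          IsSigmaMapping τ₁ ∧ IsSigmaMapping τ₂ ∧ a ∈ evenWords n ∧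
          Set.EqOn φ τ₁ (evenWords n) ∧
          Set.EqOn φ (cubeTranslation a ∘ τ₂) (oddWords n))) := by
  refine ⟨fun hn => ?_, fun hn φ hφ h0 hne => ?_⟩
  · have hn4 : n % 4 = 1 := hn
    have hp : n + 1 = 2 * ((n + 1) / 2) := by omega
    refine ⟨fun φ hφ h0 hne => ?_, fun φ hφ => ?_⟩
    · rcases Nat.lt_or_ge n 5 with h5 | h5
      · obtain rfl : n = 1 := by omega
        exact absurd (isCubeIsometry_of_length_one hφ.1) hne
      obtain ⟨π, hπ⟩ := hφ.exists_foldPerm_even hp (by omega) h0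
      have heq : φ = foldPerm π := hφ.eq_of_eqOn_even hp (by rw [Nat.even_iff]; omega)
        (foldPerm_isWeakIsometry hp π) hπ
      rw [heq] at hne ⊢
      exact foldPerm_isSigmaMapping fun h => hne (foldPerm_isCubeIsometry h)
    · obtain ⟨π, rfl⟩ := hφ.exists_foldPerm
      exact foldPerm_isWeakIsometry hp π
  · have hn4 : n % 4 = 3 := hn
    have hp : n + 1 = 2 * ((n + 1) / 2) := by omega
    rcases Nat.lt_or_ge n 7 with h7 | h7
    -- Here `p = 2` is the only even number in `{1, 2, 3}`, so `φ` is already an even isometry.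
    · obtain rfl : n = 3 := by omega
      refine absurd ⟨hφ.1, ?_⟩ hne
      rintro p ⟨⟨hp1, hp3⟩, hpe⟩
      rw [Nat.even_iff] at hpe
      exact hφ.2 p (show p = 2 by omega)
    obtain ⟨π, hπ⟩ := hφ.exists_foldPerm_even hp (by omega) h0
    obtain ⟨ρ, a, ha, hρ⟩ := hφ.exists_foldPerm_odd hp (by omega) h0
    have hE : Set.EqOn φ (foldPerm π) (evenWords n) := fun x hx => hπ x hx
    have hO : Set.EqOn φ (cubeTranslation a ∘ foldPerm ρ) (oddWords n) :=
      fun x hx => hρ x (Nat.not_even_iff_odd.2 hx)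
    by_cases h1 : π none = none <;> by_cases h2 : ρ none = none
    -- Even distances occur only within `E` or within `O`, and `φ` acts on each as an isometry.
    · refine absurd ⟨hφ.1, ?_⟩ hne
      rintro p ⟨-, hpe⟩ x y hxy
      rw [← hxy, even_hammingDist] at hpe
      rw [← hxy]
      by_cases hx : Even (hammingNorm x)
      · rw [hπ x hx, hπ y (hpe.1 hx), (foldPerm_isCubeIsometry h1).2]
      · rw [hρ x hx, hρ y (fun hy => hx (hpe.2 hy)), hammingDist_add_right,
          (foldPerm_isCubeIsometry h2).2]
    · exact Or.inl ⟨foldPerm ρ, a, foldPerm_isSigmaMapping h2, ha,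
        ⟨foldPerm π, (foldPerm_isCubeIsometry h1).isEvenIsometry, hE⟩, hO⟩
    · exact Or.inr (Or.inl ⟨foldPerm π, foldPerm_isSigmaMapping h1, hE,
        _, ((foldPerm_isCubeIsometry h2).add_right a).isEvenIsometry, hO⟩)
    · exact Or.inr (Or.inr ⟨foldPerm π, foldPerm ρ, a, foldPerm_isSigmaMapping h1,
        foldPerm_isSigmaMapping h2, ha, hE, hO⟩)
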